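/- **Theorem (unbounded Stinespring theorem).** Inner products are linear in the first variable. Let $\mathcal B$ be a C*-algebra with multiplier algebra $M(\mathcal B)$, let $(p_k)_{k\in\mathbb N}\subseteq M(\mathcal B)$ be an increasing sequence of projections, and let $\mathcal A\subseteq\mathcal B$ be a dense $*$-subalgebra with $p_n\mathcal A\subseteq\mathcal A$ and $\mathcal A p_n\subseteq\mathcal A$ for all $n$ and $\mathcal A=\bigcup_{k}p_k\mathcal A p_k$. Let $H$ be a complex Hilbert space, let $(q_k)_{k\in\mathbb N}$ be an increasing sequence of orthogonal projections on $H$ converging strongly to $I$, put $\mathcal X=\bigcup_k q_kH$, and let $\mathcal L(\mathcal X)$ be the space of all linear maps $\mathcal X\to\mathcal X$. Let $\Phi:\mathcal A\to\mathcal L(\mathcal X)$ be a linear map that is completely positive, i.e. $\sum_{k,l=1}^n(\Phi(a_k^*a_l)\xi_l,\xi_k)\ge 0$ for all $n\in\mathbb N$, $a_1,\dots,a_n\in\mathcal A$, $\xi_1,\dots,\xi_n\in\mathcal X$, and that satisfies $\Phi(p_kap_m)=q_k\Phi(a)q_m$ for all $k,m\in\mathbb N$ and $a\in\mathcal A$.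 Then the following are equivalent: (i) for each $k\in\mathbb N$ the restriction $\Phi|_{p_k\mathcal Ap_k}$ is bounded, i.e. there is a constant $C_k$ with $\|\Phi(a)\xi\|\le C_k\|a\|\|\xi\|$ for all $a\in p_k\mathcal Ap_k$ and $\xi\in\mathcal X$; (ii) there exist a Hilbert space $K$, a $*$-representation $\pi:\mathcal A\to\mathcal B(K)$ that is bounded (i.e. $\|\pi(a)\|\le C\|a\|$ for some constant $C$ and all $a\in\mathcal A$), and a linear operator $V:\mathcal X\to K$ such that $V|_{q_kH}$ is bounded for every $k\in\mathbb N$ and $$(\Phi(a)\xi,\eta)=(\pi(a)V\xi,V\eta),\qquad a\in\mathcal A,\ \xi,\eta\in\mathcal X.$$ Moreover, if (i) holds, then $K$, $\pi$ and $V$ in (ii) can be chosen so that $V$, as an operator from $H$ to $K$ with domain $\mathcal X$, is closable, and, in case $\mathcal B$ and $H$ are separable, so that in addition $K$ is separable. -/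

import Mathlib

open Filter Topology
open scoped ComplexOrder MultiplierAlgebra InnerProductSpace

universe u v w

namespace UnboundedStinespring

/-- An increasing sequence of (orthogonal) projections in a `*`-ring; for projections,
`e ≤ f` means `e * f = e`. -/
structure IsIncreasingProjections {R : Type*} [Mul R] [Star R] (e : ℕ → R) : Prop where
  isStarProjection : ∀ n, IsStarProjection (e n)
  mul_eq : ∀ m n, m ≤ n → e m * e n = e m

section Multiplier

variable {B : Type u} [NonUnitalCStarAlgebra B]

/-- The product `p b` of a multiplier `p` of `B` and an element `b` of `B`, as an element of `B`. -/
noncomputable def leftMul (p : 𝓜(ℂ, B)) (b : B) : B := p.fst b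

/-- The product `b p` of an element `b` of `B` and a multiplier `p` of `B`, as an element of `B`. -/
noncomputable def rightMul (b : B) (p : 𝓜(ℂ, B)) : B := p.snd b

/-- Inside the multiplier algebra, `leftMul p b` is the product of `p` and `b`. -/
theorem coe_leftMul (p : 𝓜(ℂ, B)) (b : B) :
    ((leftMul p b : B) : 𝓜(ℂ, B)) = p * (b : 𝓜(ℂ, B)) := by
  ext x
  · have h := p.central b
    -- Both centralizers have the same left part: `(p b) x = p (b x)`.
    have key : ∀ y : B, y * (p.fst b * x) = y * p.fst (b * x) := by
      intro y
      rw [← mul_assoc, ← p.central, mul_assoc, p.central]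
    have h0 : p.fst b * x - p.fst (b * x) = 0 := by
      rw [← CStarRing.star_mul_self_eq_zero_iff, mul_sub, key, sub_self]
    simpa [leftMul, sub_eq_zero] using h0
  · simp [leftMul, p.central]

/-- Inside the multiplier algebra, `rightMul b p` is the product of `b` and `p`. -/
theorem coe_rightMul (p : 𝓜(ℂ, B)) (b : B) :
    ((rightMul b p : B) : 𝓜(ℂ, B)) = (b : 𝓜(ℂ, B)) * p := by
  ext x
  · simp [rightMul, p.central]
  · have key : ∀ y : B, (x * p.snd b) * y = p.snd (x * b) * y := by
      intro y
      rw [mul_assoc, p.central, ← mul_assoc, ← p.central]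
    have h0 : x * p.snd b - p.snd (x * b) = 0 := by
      rw [← CStarRing.mul_star_self_eq_zero_iff, sub_mul, key, sub_self]
    simpa [rightMul, sub_eq_zero] using h0

end Multiplier

section CompletelyPositive

variable {B : Type u} [NonUnitalCStarAlgebra B] {A : NonUnitalStarSubalgebra ℂ B}
  {H : Type v} [NormedAddCommGroup H] [InnerProductSpace ℂ H] {X : Submodule ℂ H}

/-- Complete positivity of a linear map from a `*`-algebra into the linear maps on a (not
necessarily closed) subspace `X` of `H`. The inner product `⟪x, y⟫_ℂ` is linear in `y`. -/
def IsCompletelyPositive (Φ : A →ₗ[ℂ] (X →ₗ[ℂ] X)) : Prop :=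
  ∀ (n : ℕ) (a : Fin n → A) (ξ : Fin n → X),
    0 ≤ ∑ k, ∑ l, ⟪ξ k, Φ (star (a k) * a l) (ξ l)⟫_ℂ

/-- The restriction of `Φ` to the corner `p A p` is bounded: it takes values in the bounded
operators on `X`, and it is bounded from the norm of `B` to the operator norm. -/
def IsBoundedOnCorner (Φ : A →ₗ[ℂ] (X →ₗ[ℂ] X)) (p : 𝓜(ℂ, B)) : Prop :=
  ∃ C : ℝ, ∀ a b : A, (b : B) = rightMul (leftMul p (a : B)) p →
    ∀ ξ : X, ‖Φ b ξ‖ ≤ C * ‖(b : B)‖ * ‖ξ‖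

/-- `π` is a bounded `*`-representation of `A` on `K`, the operator `V` from `X` to `K` is bounded
on the range of each `q k`, and `(Φ(a)ξ, η) = (π(a)Vξ, Vη)`. -/
structure IsStinespringRep {K : Type w} [NormedAddCommGroup K] [InnerProductSpace ℂ K]
    [CompleteSpace K] (q : ℕ → (H →L[ℂ] H)) (Φ : A →ₗ[ℂ] (X →ₗ[ℂ] X))
    (π : A →⋆ₙₐ[ℂ] (K →L[ℂ] K)) (V : X →ₗ[ℂ] K) : Prop where
  bounded_rep : ∃ C : ℝ, ∀ a : A, ‖π a‖ ≤ C * ‖(a : B)‖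
  bounded_on_range : ∀ k, ∃ C : ℝ, ∀ ξ : X, (ξ : H) ∈ Set.range (q k) → ‖V ξ‖ ≤ C * ‖ξ‖
  inner_eq : ∀ (a : A) (ξ η : X), ⟪η, Φ a ξ⟫_ℂ = ⟪V η, π a (V ξ)⟫_ℂ

end CompletelyPositive

end UnboundedStinespring

/-
Write `Φ̂ : A ⊗ X → X` for the linear map `a ⊗ ξ ↦ Φ(a)ξ`. The compatibility of `Φ` with the
projections turns boundedness on the corners `p_k A p_k` into boundedness of the compressions
`q_k Φ(·) q_k` on all of `A`, so every matrix coefficient of `Φ` is norm continuous. Complete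
positivity makes `(a ⊗ ξ, b ⊗ η) ↦ ⟪ξ, Φ(a* b)η⟫` a semi-inner product on `A ⊗ X`, with Hilbert
completion `J : A ⊗ X → K`, on which `A` acts by left multiplication. This action is contractive:
for `v = J x` the map `F a = J (a x)` satisfies `‖F a‖² = ⟪v, F (a* a)⟫`, which first shows that
`F` is continuous and then that `‖F‖² ≤ ‖v‖ ‖F‖`.

As `A` has no unit, `Vξ` cannot be defined as `J (1 ⊗ ξ)`. Instead it represents the functional
`J z ↦ ⟪ξ, Φ̂ z⟫`, which is bounded because it is the limit of `J z ↦ ⟪J (e* ⊗ ξ), J z⟫` along a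
bounded approximate unit `e`. Thus `V` is formally adjoint to the densely defined `J z ↦ Φ̂ z`,
whence it is closable.
-/

namespace UnboundedStinespring

open TensorProduct TopologicalSpace

theorem le_of_mul_self_le_mul_right {R : Type*} [Semiring R] [LinearOrder R]
    [IsStrictOrderedRing R] {a c : R} (hc : 0 ≤ c) (h : a * a ≤ c * a) : a ≤ c :=
  le_of_not_gt fun hca => (mul_lt_mul_of_pos_right hca (hc.trans_lt hca)).not_ge h

section DenseRange

variable {𝕜 : Type*} [RCLike 𝕜] {E F K : Type*} [AddCommGroup E] [Module 𝕜 E]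
  [NormedAddCommGroup F] [InnerProductSpace 𝕜 F] [NormedAddCommGroup K] [InnerProductSpace 𝕜 K]
  {J : E →ₗ[𝕜] K}

theorem exists_inner_eq_of_norm_le [CompleteSpace K] (hJ : DenseRange J) {φ : E →ₗ[𝕜] 𝕜} {M : ℝ}
    (hφ : ∀ z, ‖φ z‖ ≤ M * ‖J z‖) : ∃ v : K, ∀ z, ⟪v, J z⟫_𝕜 = φ z :=
  ⟨(InnerProductSpace.toDual 𝕜 K).symm (φ.extendOfNorm J), fun z => by
    rw [InnerProductSpace.toDual_symm_apply, LinearMap.extendOfNorm_eq hJ ⟨M, hφ⟩]⟩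

theorem norm_le_of_norm_inner_le (hJ : DenseRange J) {v : K} {M : ℝ} (hM : 0 ≤ M)
    (h : ∀ z, ‖⟪v, J z⟫_𝕜‖ ≤ M * ‖J z‖) : ‖v‖ ≤ M := by
  have hv : ‖⟪v, v⟫_𝕜‖ ≤ M * ‖v‖ :=
    hJ.induction (P := fun w => ‖⟪v, w⟫_𝕜‖ ≤ M * ‖w‖) (Set.forall_mem_range.2 h)
      (isClosed_le (by fun_prop) (by fun_prop)) v
  rw [← inner_self_re_eq_norm, inner_self_eq_norm_mul_norm] at hv
  exact le_of_mul_self_le_mul_right hM hv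

theorem exists_linearMap_inner_eq [CompleteSpace K] (hJ : DenseRange J) {G : E →ₗ[𝕜] F}
    (hG : ∀ ξ : F, ∃ M : ℝ, ∀ z, ‖⟪ξ, G z⟫_𝕜‖ ≤ M * ‖J z‖) :
    ∃ V : F →ₗ[𝕜] K, ∀ ξ z, ⟪V ξ, J z⟫_𝕜 = ⟪ξ, G z⟫_𝕜 := by
  have hV (ξ : F) : ∃ v : K, ∀ z, ⟪v, J z⟫_𝕜 = ⟪ξ, G z⟫_𝕜 := by
    obtain ⟨M, hM⟩ := hG ξ
    exact exists_inner_eq_of_norm_le (φ := innerₛₗ 𝕜 ξ ∘ₗ G) hJ hM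
  choose V hV using hV
  exact ⟨{ toFun := V
           map_add' ξ η := hJ.eq_of_inner_left 𝕜 fun z => by
             simp only [inner_add_left, hV]
           map_smul' c ξ := hJ.eq_of_inner_left 𝕜 fun z => by
             simp only [inner_smul_left, hV, RingHom.id_apply] }, hV⟩

theorem isClosable_of_inner_eq {ι : Type*} {j : ι → K} (hj : DenseRange j) {g : ι → F}
    {T : F →ₗ.[𝕜] K} (hT : ∀ (ξ : T.domain) (i : ι), ⟪T ξ, j i⟫_𝕜 = ⟪(ξ : F), g i⟫_𝕜) :
    T.IsClosable := by
  have hgraph : ∀ x ∈ T.graph.topologicalClosure, ∀ i, ⟪x.2, j i⟫_𝕜 = ⟪x.1, g i⟫_𝕜 := by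
    intro x hx i
    refine closure_minimal (t := {x : F × K | ⟪x.2, j i⟫_𝕜 = ⟪x.1, g i⟫_𝕜}) ?_
      (isClosed_eq (by fun_prop) (by fun_prop)) hx
    rintro ⟨_, _⟩ hy
    obtain ⟨ξ, rfl, rfl⟩ := T.mem_graph_iff.1 hy
    exact hT ξ i
  refine ⟨_, (Submodule.toLinearPMap_graph_eq _ fun x hx hx₀ => ?_).symm⟩
  refine hj.eq_of_inner_left 𝕜 fun i => ?_
  rw [hgraph x hx i, hx₀, inner_zero_left, inner_zero_left]

end DenseRange

section HilbertCompletion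

variable {𝕜 : Type*} [RCLike 𝕜] {E : Type u} [AddCommGroup E] [Module 𝕜 E]
  {S : E →ₗ⋆[𝕜] E →ₗ[𝕜] 𝕜} {K : Type w} [NormedAddCommGroup K] [InnerProductSpace 𝕜 K]

/-- `J` exhibits `K` as the Hilbert space obtained from the semi-inner product `S` on `E` by
dividing out its null vectors and completing. Completeness of `K` is left to the instances. -/
structure IsHilbertCompletion (S : E →ₗ⋆[𝕜] E →ₗ[𝕜] 𝕜) (J : E →ₗ[𝕜] K) : Prop where
  inner_eq : ∀ x y, ⟪J x, J y⟫_𝕜 = S x y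
  denseRange : DenseRange J

theorem exists_isHilbertCompletion (hS : S.IsPosSemidef) :
    ∃ (K : Type u) (_ : NormedAddCommGroup K) (_ : InnerProductSpace 𝕜 K) (_ : CompleteSpace K)
      (J : E →ₗ[𝕜] K), IsHilbertCompletion S J := by
  let core : PreInnerProductSpace.Core 𝕜 E :=
    { inner x y := S x y
      conj_inner_symm x y := hS.isSymm.eq y x
      re_inner_nonneg x := (RCLike.nonneg_iff.1 (hS.isNonneg.nonneg x)).1
      add_left x y z := by simp only [map_add, LinearMap.add_apply]
      smul_left x y r := by
        simp only [LinearMap.map_smulₛₗ, LinearMap.smul_apply, smul_eq_mul] }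
  let : SeminormedAddCommGroup E := InnerProductSpace.Core.toSeminormedAddCommGroup (c := core)
  let : InnerProductSpace 𝕜 E := InnerProductSpace.ofCore core
  exact ⟨UniformSpace.Completion E, inferInstance, inferInstance, inferInstance,
    (UniformSpace.Completion.toComplL : E →L[𝕜] UniformSpace.Completion E),
    fun x y => UniformSpace.Completion.inner_coe x y, UniformSpace.Completion.denseRange_coe⟩

theorem isPosSemidef_of_isNonneg {E : Type*} [AddCommGroup E] [Module ℂ E]
    {S : E →ₗ⋆[ℂ] E →ₗ[ℂ] ℂ} (hS : S.IsNonneg) : S.IsPosSemidef where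
  nonneg := hS.nonneg
  eq x y := by
    have him (z : E) : (S z z).im = 0 := (Complex.nonneg_iff.1 (hS.nonneg z)).2.symm
    have hadd := him (x + y)
    have hsmul := him (x + Complex.I • y)
    simp only [map_add, LinearMap.add_apply, Complex.add_im, him, LinearMap.map_smulₛₗ,
      LinearMap.smul_apply, RingHom.id_apply, Complex.conj_I, smul_eq_mul, Complex.mul_im,
      Complex.add_re, Complex.mul_re, Complex.neg_re, Complex.neg_im, Complex.I_re,
      Complex.I_im] at hadd hsmul
    apply Complex.ext
    · rw [Complex.conj_re]
      linarith
    · rw [Complex.conj_im]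
      linarith

variable {𝓐 : Type*} [NonUnitalNormedRing 𝓐] [NormedSpace 𝕜 𝓐] [StarRing 𝓐] [NormedStarGroup 𝓐]
  {ρ : 𝓐 →ₙₐ[𝕜] Module.End 𝕜 E} {J : E →ₗ[𝕜] K}

theorem norm_le_of_norm_apply_sq_le {F : 𝓐 →L[𝕜] K} {c : ℝ} (hc : 0 ≤ c)
    (hF : ∀ a, ‖F a‖ ^ 2 ≤ c * ‖F (star a * a)‖) : ‖F‖ ≤ c := by
  have hsqrt : ‖F‖ ≤ √(c * ‖F‖) := F.opNorm_le_bound (Real.sqrt_nonneg _) fun a => by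
    rw [← Real.sqrt_sq (norm_nonneg a), ← Real.sqrt_mul (by positivity)]
    refine Real.le_sqrt_of_sq_le ((hF a).trans ?_)
    calc c * ‖F (star a * a)‖ ≤ c * (‖F‖ * (‖star a‖ * ‖a‖)) := by
          gcongr
          exact F.le_opNorm_of_le (norm_mul_le _ _)
      _ = c * ‖F‖ * ‖a‖ ^ 2 := by rw [norm_star]; ring
  have hsq : ‖F‖ * ‖F‖ ≤ c * ‖F‖ := by
    rw [← sq]
    exact (Real.le_sqrt (norm_nonneg F) (by positivity)).1 hsqrt
  exact le_of_mul_self_le_mul_right hc hsq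

theorem continuous_of_inner_apply_self_eq {F : 𝓐 →ₗ[𝕜] K} {v : K}
    (hF : ∀ a, ⟪F a, F a⟫_𝕜 = ⟪v, F (star a * a)⟫_𝕜) (hv : Continuous fun a => ⟪v, F a⟫_𝕜) :
    Continuous F := by
  have hnorm : Continuous fun a => ‖F a‖ := by
    simp only [norm_eq_sqrt_re_inner (𝕜 := 𝕜), hF]
    exact Real.continuous_sqrt.comp <| RCLike.continuous_re.comp <|
      hv.comp (continuous_star.mul continuous_id)
  refine continuous_of_continuousAt_zero F ?_
  rw [ContinuousAt, map_zero, tendsto_zero_iff_norm_tendsto_zero]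
  simpa only [map_zero, norm_zero] using hnorm.tendsto 0

theorem norm_le_of_inner_apply_self_eq {F : 𝓐 →L[𝕜] K} {v : K}
    (hF : ∀ a, ⟪F a, F a⟫_𝕜 = ⟪v, F (star a * a)⟫_𝕜) : ‖F‖ ≤ ‖v‖ :=
  norm_le_of_norm_apply_sq_le (norm_nonneg v) fun a =>
    calc ‖F a‖ ^ 2 = ‖⟪v, F (star a * a)⟫_𝕜‖ := by
          rw [← hF, ← inner_self_re_eq_norm, inner_self_eq_norm_sq]
      _ ≤ ‖v‖ * ‖F (star a * a)‖ := norm_inner_le_norm _ _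

theorem IsHilbertCompletion.norm_apply_le (hJ : IsHilbertCompletion S J)
    (hadj : ∀ a x y, S (ρ a x) y = S x (ρ (star a) y))
    (hcont : ∀ x, Continuous fun a => S x (ρ a x)) (a : 𝓐) (x : E) :
    ‖J (ρ a x)‖ ≤ ‖a‖ * ‖J x‖ := by
  let F₀ : 𝓐 →ₗ[𝕜] K := J ∘ₗ LinearMap.applyₗ x ∘ₗ (ρ : 𝓐 →ₗ[𝕜] Module.End 𝕜 E)
  have hF₀ (b : 𝓐) : ⟪F₀ b, F₀ b⟫_𝕜 = ⟪J x, F₀ (star b * b)⟫_𝕜 := by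
    change ⟪J (ρ b x), J (ρ b x)⟫_𝕜 = ⟪J x, J (ρ (star b * b) x)⟫_𝕜
    rw [hJ.inner_eq, hJ.inner_eq, hadj, map_mul, Module.End.mul_apply]
  let F : 𝓐 →L[𝕜] K := ⟨F₀, continuous_of_inner_apply_self_eq hF₀ <|
    (hcont x).congr fun b => (hJ.inner_eq x (ρ b x)).symm⟩
  have hF : ‖F‖ ≤ ‖J x‖ := norm_le_of_inner_apply_self_eq hF₀
  calc ‖J (ρ a x)‖ ≤ ‖F‖ * ‖a‖ := F.le_opNorm a
    _ ≤ ‖a‖ * ‖J x‖ := by rw [mul_comm]; gcongr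

theorem IsHilbertCompletion.exists_starAlgHom [CompleteSpace K] (hJ : IsHilbertCompletion S J)
    (hadj : ∀ a x y, S (ρ a x) y = S x (ρ (star a) y))
    (hcont : ∀ x, Continuous fun a => S x (ρ a x)) :
    ∃ π : 𝓐 →⋆ₙₐ[𝕜] (K →L[𝕜] K), (∀ a, ‖π a‖ ≤ ‖a‖) ∧ ∀ a x, π a (J x) = J (ρ a x) := by
  have hbound := hJ.norm_apply_le hadj hcont
  let π (a : 𝓐) : K →L[𝕜] K := (J ∘ₗ ρ a).extendOfNorm J
  have hπ (a : 𝓐) (x : E) : π a (J x) = J (ρ a x) :=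
    LinearMap.extendOfNorm_eq hJ.denseRange ⟨‖a‖, hbound a⟩ x
  have hext {T T' : K →L[𝕜] K} (h : ∀ x, T (J x) = T' (J x)) : T = T' :=
    DFunLike.coe_injective (hJ.denseRange.equalizer T.continuous T'.continuous (funext h))
  exact ⟨{ toFun := π
           map_smul' c a := hext fun x => by simp [hπ]
           map_zero' := hext fun x => by simp [hπ]
           map_add' a b := hext fun x => by simp [hπ]
           map_mul' a b := hext fun x => by simp [hπ]
           map_star' a := (ContinuousLinearMap.eq_adjoint_iff _ _).2 fun u v =>
             hJ.denseRange.induction_on₂ (isClosed_eq (by fun_prop) (by fun_prop))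
               (fun x y => by simp only [hπ, hJ.inner_eq, hadj, star_star]) u v },
    fun a => LinearMap.opNorm_extendOfNorm_le hJ.denseRange (norm_nonneg a) (hbound a), hπ⟩

end HilbertCompletion

section ApproximateUnit

theorem exists_isApproximateUnit_of_denseRange {𝓐 R : Type*} [Mul 𝓐] [TopologicalSpace 𝓐]
    [NonUnitalSeminormedRing R] {j : 𝓐 →ₙ* R} (hj : IsInducing j) (hdense : DenseRange j)
    {l : Filter R} (hl : l.IsApproximateUnit) {C : ℝ} (hC : ∀ᶠ e in l, ‖e‖ < C) :
    ∃ m : Filter 𝓐, m.IsApproximateUnit ∧ ∀ᶠ e in m, ‖j e‖ < C := by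
  have hopen {U : Set R} (hU : IsOpen U) (h : ∀ᶠ x in l, x ∈ U) : ∀ᶠ x in l.bind 𝓝, x ∈ U :=
    eventually_bind.2 (h.mono fun _ hx => hU.mem_nhds hx)
  have htendsto {f : R → R} {y : R} (hf : Continuous f) (h : Tendsto f l (𝓝 y)) :
      Tendsto f (l.bind 𝓝) (𝓝 y) :=
    tendsto_nhds.2 fun U hU hy => hopen (hU.preimage hf) (h (hU.mem_nhds hy))
  have hneBot : ((l.bind 𝓝).comap j).NeBot := comap_neBot fun t ht => by
    have := hl.neBot
    obtain ⟨x, hx⟩ := Eventually.exists (f := l) (mem_bind'.1 ht)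
    obtain ⟨_, hat, a, rfl⟩ := mem_closure_iff_nhds.1 (hdense x) t hx
    exact ⟨a, hat⟩
  refine ⟨(l.bind 𝓝).comap j, ⟨fun a => ?_, fun a => ?_⟩, ?_⟩
  · simpa only [hj.tendsto_nhds_iff, Function.comp_def, map_mul] using
      (htendsto (continuous_const_mul _) (hl.tendsto_mul_left (j a))).comp tendsto_comap
  · simpa only [hj.tendsto_nhds_iff, Function.comp_def, map_mul] using
      (htendsto (continuous_mul_const _) (hl.tendsto_mul_right (j a))).comp tendsto_comap
  · exact (hopen (isOpen_lt continuous_norm continuous_const) hC).comap j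

theorem exists_isApproximateUnit_norm_lt {B : Type*} [NonUnitalCStarAlgebra B]
    (A : NonUnitalStarSubalgebra ℂ B) {C : ℝ} (hC : 1 < C) :
    ∃ l : Filter A, l.IsApproximateUnit ∧ ∀ᶠ e in l, ‖e‖ < C := by
  have : IsClosed (A.topologicalClosure : Set B) := A.isClosed_topologicalClosure
  let : NonUnitalCStarAlgebra A.topologicalClosure :=
    NonUnitalStarSubalgebra.nonUnitalCStarAlgebra A.topologicalClosure
  let := CStarAlgebra.spectralOrder A.topologicalClosure
  have := CStarAlgebra.spectralOrderedRing A.topologicalClosure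
  have hl := CStarAlgebra.increasingApproximateUnit A.topologicalClosure
  exact exists_isApproximateUnit_of_denseRange
    (j := (NonUnitalStarSubalgebra.inclusion A.le_topologicalClosure : A →ₙ* A.topologicalClosure))
    (IsEmbedding.inclusion A.le_topologicalClosure).isInducing
    ((denseRange_inclusion_iff A.le_topologicalClosure).2 subset_rfl)
    hl.toIsApproximateUnit (hl.eventually_norm.mono fun e he => he.trans_lt hC)

end ApproximateUnit

section StinespringForm

variable {B : Type u} [NonUnitalCStarAlgebra B] {A : NonUnitalStarSubalgebra ℂ B}
  {H : Type v} [NormedAddCommGroup H] [InnerProductSpace ℂ H] {X : Submodule ℂ H}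

instance : NormedStarGroup A := ⟨fun a => (norm_star (a : B)).le⟩

variable (A X) in
/-- The action of `A` on `A ⊗ X` by left multiplication on the first factor: the algebraic model of
the dilation `π`. -/
noncomputable def tensorLeftMul : A →ₙₐ[ℂ] Module.End ℂ (A ⊗[ℂ] X) :=
  ((Module.End.rTensorAlgHom ℂ A X : _ →ₐ[ℂ] _) : _ →ₙₐ[ℂ] _).comp (NonUnitalAlgHom.lmul ℂ A)

theorem tensorLeftMul_tmul (a b : A) (ξ : X) :
    tensorLeftMul A X a (b ⊗ₜ ξ) = (a * b) ⊗ₜ[ℂ] ξ := rfl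

/-- The sesquilinear form `(a ⊗ ξ, b ⊗ η) ↦ ⟪ξ, Φ (a* b) η⟫` on `A ⊗ X` whose Hilbert completion
carries the Stinespring dilation of `Φ`. -/
noncomputable def stinespringForm (Φ : A →ₗ[ℂ] (X →ₗ[ℂ] X)) :
    (A ⊗[ℂ] X) →ₗ⋆[ℂ] (A ⊗[ℂ] X) →ₗ[ℂ] ℂ :=
  TensorProduct.lift <| LinearMap.mk₂'ₛₗ (starRingEnd ℂ) (starRingEnd ℂ)
    (fun a ξ => innerₛₗ ℂ ξ ∘ₗ TensorProduct.lift Φ ∘ₗ tensorLeftMul A X (star a))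
    (fun a b ξ => by ext; simp [inner_add_right])
    (fun c a ξ => by ext; simp [inner_smul_right])
    (fun a ξ η => by ext; simp)
    (fun c a ξ => by ext; simp)

variable {Φ : A →ₗ[ℂ] (X →ₗ[ℂ] X)}

theorem stinespringForm_tmul_left (a : A) (ξ : X) (z : A ⊗[ℂ] X) :
    stinespringForm Φ (a ⊗ₜ ξ) z = ⟪ξ, TensorProduct.lift Φ (tensorLeftMul A X (star a) z)⟫_ℂ :=
  rfl

theorem stinespringForm_tmul_tmul (a b : A) (ξ η : X) :
    stinespringForm Φ (a ⊗ₜ ξ) (b ⊗ₜ η) = ⟪ξ, Φ (star a * b) η⟫_ℂ := rfl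

theorem IsCompletelyPositive.isPosSemidef_stinespringForm (hΦ : IsCompletelyPositive Φ) :
    (stinespringForm Φ).IsPosSemidef := by
  refine isPosSemidef_of_isNonneg ⟨fun z => ?_⟩
  obtain ⟨n, a, ξ, rfl⟩ := z.exists_sum_tmul_eq
  simp only [map_sum, LinearMap.sum_apply, stinespringForm_tmul_tmul]
  rw [Finset.sum_comm]
  exact hΦ n a ξ

theorem stinespringForm_tensorLeftMul (a : A) (x y : A ⊗[ℂ] X) :
    stinespringForm Φ (tensorLeftMul A X a x) y =
      stinespringForm Φ x (tensorLeftMul A X (star a) y) := by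
  induction x with
  | zero => simp only [map_zero, LinearMap.zero_apply]
  | add x₁ x₂ h₁ h₂ => simp only [map_add, LinearMap.add_apply, h₁, h₂]
  | tmul b ξ =>
    rw [tensorLeftMul_tmul, stinespringForm_tmul_left, stinespringForm_tmul_left, star_mul, map_mul,
      Module.End.mul_apply]

/-- The matrix coefficients of `Φ` are continuous in the norm of `A`: all the continuity that the
dilation of `Φ` requires. -/
def IsWeaklyContinuous (Φ : A →ₗ[ℂ] (X →ₗ[ℂ] X)) : Prop :=
  ∀ ξ η : X, Continuous fun a : A => ⟪ξ, Φ a η⟫_ℂ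

theorem IsWeaklyContinuous.continuous_inner_lift (hc : IsWeaklyContinuous Φ) (ξ : X)
    (z : A ⊗[ℂ] X) :
    Continuous fun a => ⟪ξ, TensorProduct.lift Φ (tensorLeftMul A X a z)⟫_ℂ := by
  induction z with
  | zero => simp only [map_zero, inner_zero_right, continuous_const]
  | add x y hx hy =>
    simp only [map_add, inner_add_right]
    exact hx.add hy
  | tmul b η => exact (hc ξ η).comp (continuous_mul_const b)

theorem IsWeaklyContinuous.continuous_stinespringForm (hc : IsWeaklyContinuous Φ)
    (x y : A ⊗[ℂ] X) :
    Continuous fun a => stinespringForm Φ x (tensorLeftMul A X a y) := by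
  induction x with
  | zero => simp only [map_zero, LinearMap.zero_apply, continuous_const]
  | add x₁ x₂ h₁ h₂ =>
    simp only [map_add, LinearMap.add_apply]
    exact h₁.add h₂
  | tmul b ξ =>
    simp only [stinespringForm_tmul_left, ← Module.End.mul_apply, ← map_mul]
    exact (hc.continuous_inner_lift ξ y).comp (continuous_const_mul (star b))

theorem IsWeaklyContinuous.tendsto_inner_lift (hc : IsWeaklyContinuous Φ) {l : Filter A}
    (hl : l.IsApproximateUnit) (ξ : X) (z : A ⊗[ℂ] X) :
    Tendsto (fun e => ⟪ξ, TensorProduct.lift Φ (tensorLeftMul A X e z)⟫_ℂ) l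
      (𝓝 ⟪ξ, TensorProduct.lift Φ z⟫_ℂ) := by
  induction z with
  | zero => simp only [map_zero, inner_zero_right, tendsto_const_nhds]
  | add x y hx hy =>
    simp only [map_add, inner_add_right]
    exact hx.add hy
  | tmul b η => exact ((hc ξ η).tendsto b).comp (hl.tendsto_mul_right b)

variable {K : Type w} [NormedAddCommGroup K] [InnerProductSpace ℂ K] {J : A ⊗[ℂ] X →ₗ[ℂ] K}

theorem norm_sq_tmul (hJ : IsHilbertCompletion (stinespringForm Φ) J) (a : A) (ξ : X) :
    ‖J (a ⊗ₜ ξ)‖ ^ 2 = ‖⟪ξ, Φ (star a * a) ξ⟫_ℂ‖ := by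
  rw [← stinespringForm_tmul_tmul, ← hJ.inner_eq, ← inner_self_re_eq_norm, inner_self_eq_norm_sq]

theorem IsWeaklyContinuous.norm_inner_lift_le (hc : IsWeaklyContinuous Φ)
    (hJ : IsHilbertCompletion (stinespringForm Φ) J) {ξ : X} {D : ℝ} (hD₀ : 0 ≤ D)
    (hD : ∀ a : A, ‖⟪ξ, Φ a ξ⟫_ℂ‖ ≤ D ^ 2 * ‖a‖) (z : A ⊗[ℂ] X) :
    ‖⟪ξ, TensorProduct.lift Φ z⟫_ℂ‖ ≤ 2 * D * ‖J z‖ := by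
  obtain ⟨l, hl, hl₂⟩ := exists_isApproximateUnit_norm_lt A one_lt_two
  have := hl.neBot
  refine le_of_tendsto (hc.tendsto_inner_lift hl ξ z).norm (hl₂.mono fun e he => ?_)
  have hJe : ‖J (star e ⊗ₜ ξ)‖ ≤ 2 * D := by
    refine (sq_le_sq₀ (norm_nonneg _) (by positivity)).1 ?_
    have hstar : ‖star (star e) * star e‖ ≤ 2 * 2 := by
      refine (norm_mul_le _ _).trans ?_
      rw [star_star, norm_star]
      gcongr
    calc ‖J (star e ⊗ₜ ξ)‖ ^ 2 ≤ D ^ 2 * ‖star (star e) * star e‖ := norm_sq_tmul hJ _ _ ▸ hD _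
      _ ≤ D ^ 2 * (2 * 2) := by gcongr
      _ = (2 * D) ^ 2 := by ring
  calc ‖⟪ξ, TensorProduct.lift Φ (tensorLeftMul A X e z)⟫_ℂ‖ = ‖⟪J (star e ⊗ₜ ξ), J z⟫_ℂ‖ := by
        rw [hJ.inner_eq, stinespringForm_tmul_left, star_star]
    _ ≤ ‖J (star e ⊗ₜ ξ)‖ * ‖J z‖ := norm_inner_le_norm _ _
    _ ≤ 2 * D * ‖J z‖ := by gcongr

theorem IsWeaklyContinuous.exists_norm_inner_lift_le (hc : IsWeaklyContinuous Φ)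
    (hJ : IsHilbertCompletion (stinespringForm Φ) J) (ξ : X) :
    ∃ M : ℝ, ∀ z, ‖⟪ξ, TensorProduct.lift Φ z⟫_ℂ‖ ≤ M * ‖J z‖ := by
  let φ : A →L[ℂ] ℂ := ⟨innerₛₗ ℂ ξ ∘ₗ LinearMap.applyₗ ξ ∘ₗ Φ, hc ξ ξ⟩
  refine ⟨2 * √‖φ‖, hc.norm_inner_lift_le hJ (Real.sqrt_nonneg _) fun a => ?_⟩
  rw [Real.sq_sqrt (norm_nonneg φ)]
  exact φ.le_opNorm a

end StinespringForm

section Dilation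

variable {B : Type u} [NonUnitalCStarAlgebra B] {A : NonUnitalStarSubalgebra ℂ B}
  {H : Type v} [NormedAddCommGroup H] [InnerProductSpace ℂ H] {X : Submodule ℂ H}
  {Φ : A →ₗ[ℂ] (X →ₗ[ℂ] X)}
  {K : Type w} [NormedAddCommGroup K] [InnerProductSpace ℂ K] [CompleteSpace K]
  {J : A ⊗[ℂ] X →ₗ[ℂ] K} {π : A →⋆ₙₐ[ℂ] (K →L[ℂ] K)} {V : X →ₗ[ℂ] K}

/-- The minimal Stinespring dilation `(K, π, V)` of `Φ`: the vectors `J (a ⊗ ξ) = π(a)Vξ` span a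
dense subspace of `K`, and `inner_eq` says that `V` is formally adjoint to `J (a ⊗ ξ) ↦ Φ(a)ξ`. -/
structure IsMinimalDilation (Φ : A →ₗ[ℂ] (X →ₗ[ℂ] X)) (J : A ⊗[ℂ] X →ₗ[ℂ] K)
    (π : A →⋆ₙₐ[ℂ] (K →L[ℂ] K)) (V : X →ₗ[ℂ] K) : Prop where
  isHilbertCompletion : IsHilbertCompletion (stinespringForm Φ) J
  norm_le : ∀ a, ‖π a‖ ≤ ‖a‖
  apply_eq : ∀ a ξ, π a (V ξ) = J (a ⊗ₜ ξ)
  inner_eq : ∀ ξ z, ⟪V ξ, J z⟫_ℂ = ⟪ξ, TensorProduct.lift Φ z⟫_ℂ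

theorem IsCompletelyPositive.exists_isMinimalDilation (hΦ : IsCompletelyPositive Φ)
    (hc : IsWeaklyContinuous Φ) :
    ∃ (K : Type (max u v)) (_ : NormedAddCommGroup K) (_ : InnerProductSpace ℂ K)
      (_ : CompleteSpace K) (J : A ⊗[ℂ] X →ₗ[ℂ] K) (π : A →⋆ₙₐ[ℂ] (K →L[ℂ] K))
      (V : X →ₗ[ℂ] K), IsMinimalDilation Φ J π V := by
  obtain ⟨K, _, _, _, J, hJ⟩ := exists_isHilbertCompletion hΦ.isPosSemidef_stinespringForm
  obtain ⟨π, hπ, hπJ⟩ := hJ.exists_starAlgHom stinespringForm_tensorLeftMul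
    fun x => hc.continuous_stinespringForm x x
  obtain ⟨V, hV⟩ := exists_linearMap_inner_eq hJ.denseRange (hc.exists_norm_inner_lift_le hJ)
  refine ⟨K, _, _, ‹_›, J, π, V, hJ, hπ, fun a ξ => ?_, hV⟩
  refine hJ.denseRange.eq_of_inner_left ℂ fun z => ?_
  calc ⟪π a (V ξ), J z⟫_ℂ = ⟪V ξ, π (star a) (J z)⟫_ℂ := by
        rw [map_star, ContinuousLinearMap.star_eq_adjoint, ContinuousLinearMap.adjoint_inner_right]
    _ = ⟪ξ, TensorProduct.lift Φ (tensorLeftMul A X (star a) z)⟫_ℂ := by rw [hπJ, hV]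
    _ = ⟪J (a ⊗ₜ ξ), J z⟫_ℂ := by rw [hJ.inner_eq, stinespringForm_tmul_left]

theorem IsMinimalDilation.inner_apply_eq (h : IsMinimalDilation Φ J π V) (a : A) (ξ η : X) :
    ⟪η, Φ a ξ⟫_ℂ = ⟪V η, π a (V ξ)⟫_ℂ := by
  rw [h.apply_eq, h.inner_eq, TensorProduct.lift.tmul]

theorem IsMinimalDilation.norm_apply_le (h : IsMinimalDilation Φ J π V)
    (hc : IsWeaklyContinuous Φ) {ξ : X} {D : ℝ} (hD₀ : 0 ≤ D)
    (hD : ∀ a : A, ‖⟪ξ, Φ a ξ⟫_ℂ‖ ≤ D ^ 2 * ‖a‖) : ‖V ξ‖ ≤ 2 * D :=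
  norm_le_of_norm_inner_le h.isHilbertCompletion.denseRange (by positivity) fun z => by
    rw [h.inner_eq]
    exact hc.norm_inner_lift_le h.isHilbertCompletion hD₀ hD z

theorem IsMinimalDilation.isClosable (h : IsMinimalDilation Φ J π V) :
    LinearPMap.IsClosable (⟨X, V⟩ : H →ₗ.[ℂ] K) :=
  isClosable_of_inner_eq (g := fun z => (TensorProduct.lift Φ z : H))
    h.isHilbertCompletion.denseRange h.inner_eq

theorem IsMinimalDilation.separableSpace [SeparableSpace A] (h : IsMinimalDilation Φ J π V)
    (hV : IsSeparable (Set.range V)) : SeparableSpace K := by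
  have hπ : Continuous π :=
    (LinearMap.mkContinuous (π : A →ₗ[ℂ] (K →L[ℂ] K)) 1 fun a => by
      simpa using h.norm_le a).continuous
  let orbit : Set K := (fun x : A × K => π x.1 x.2) '' (Set.univ ×ˢ Set.range V)
  have horbit : IsSeparable orbit :=
    ((IsSeparable.of_separableSpace Set.univ).prod hV).image
      ((hπ.comp continuous_fst).clm_apply continuous_snd)
  have hrange : Set.range J ⊆ Submodule.span ℂ orbit := by
    rintro _ ⟨z, rfl⟩
    induction z with
    | zero => simp only [map_zero, SetLike.mem_coe, zero_mem]
    | add x y hx hy => simpa only [map_add, SetLike.mem_coe] using add_mem hx hy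
    | tmul a ξ =>
      rw [← h.apply_eq]
      exact Submodule.subset_span ⟨(a, V ξ), ⟨trivial, ξ, rfl⟩, rfl⟩
  have hdense : Dense (Submodule.span ℂ orbit : Set K) :=
    Dense.mono hrange h.isHilbertCompletion.denseRange
  exact isSeparable_univ_iff.1 (hdense.closure_eq ▸ (horbit.span (R := ℂ)).closure)

end Dilation

section Filtration

variable {B : Type u} [NonUnitalCStarAlgebra B] {A : NonUnitalStarSubalgebra ℂ B}
  {H : Type v} [NormedAddCommGroup H] [InnerProductSpace ℂ H] {X : Submodule ℂ H}
  {Φ : A →ₗ[ℂ] (X →ₗ[ℂ] X)}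

/-- The compressions `q Φ(a) q`, as sesquilinear forms on the range of `q`, are bounded by a
multiple of `‖a‖`: the counterpart on all of `A` of boundedness on the corner `p A p`. -/
def IsBoundedCompression (Φ : A →ₗ[ℂ] (X →ₗ[ℂ] X)) (q : H →L[ℂ] H) : Prop :=
  ∃ C : ℝ, 0 ≤ C ∧ ∀ (a : A) (ξ η : X), (ξ : H) ∈ Set.range q → (η : H) ∈ Set.range q →
    ‖⟪η, Φ a ξ⟫_ℂ‖ ≤ C * ‖a‖ * ‖ξ‖ * ‖η‖

theorem IsBoundedCompression.continuous_inner {q : H →L[ℂ] H} (h : IsBoundedCompression Φ q)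
    {ξ η : X} (hξ : (ξ : H) ∈ Set.range q) (hη : (η : H) ∈ Set.range q) :
    Continuous fun a => ⟪η, Φ a ξ⟫_ℂ := by
  obtain ⟨C, -, hC⟩ := h
  exact (LinearMap.mkContinuous (innerₛₗ ℂ η ∘ₗ LinearMap.applyₗ ξ ∘ₗ Φ) (C * ‖ξ‖ * ‖η‖)
    fun a => (hC a ξ η hξ hη).trans_eq (by ring)).continuous

theorem norm_rightMul_leftMul_le (p : 𝓜(ℂ, B)) (b : B) :
    ‖rightMul (leftMul p b) p‖ ≤ ‖p‖ ^ 2 * ‖b‖ :=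
  calc ‖p.snd (p.fst b)‖ ≤ ‖p.snd‖ * (‖p.fst‖ * ‖b‖) :=
        p.snd.le_opNorm_of_le (p.fst.le_opNorm b)
    _ = ‖p‖ ^ 2 * ‖b‖ := by rw [DoubleCentralizer.norm_fst, DoubleCentralizer.norm_snd]; ring

theorem apply_eq_of_mem_range {q : H →L[ℂ] H} (hq : IsIdempotentElem q) {x : H}
    (hx : x ∈ Set.range q) : q x = x := by
  obtain ⟨y, rfl⟩ := hx
  exact DFunLike.congr_fun hq.eq y

section Corner

variable [CompleteSpace H] {q : H →L[ℂ] H} {p : 𝓜(ℂ, B)}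

theorem IsBoundedOnCorner.isBoundedCompression (h : IsBoundedOnCorner Φ p)
    (hq : IsStarProjection q) (hpA : ∀ a ∈ A, rightMul (leftMul p a) p ∈ A) (hqX : ∀ x, q x ∈ X)
    (hcomp : ∀ (a : A) (ξ : X), (Φ ⟨rightMul (leftMul p (a : B)) p, hpA a a.2⟩ ξ : H) =
      q (Φ a ⟨q ξ, hqX ξ⟩)) :
    IsBoundedCompression Φ q := by
  obtain ⟨C, hC⟩ := h
  refine ⟨|C| * ‖p‖ ^ 2, by positivity, fun a ξ η hξ hη => ?_⟩
  let b : A := ⟨rightMul (leftMul p (a : B)) p, hpA a a.2⟩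
  have hqξ : (⟨q ξ, hqX ξ⟩ : X) = ξ := Subtype.ext (apply_eq_of_mem_range hq.isIdempotentElem hξ)
  have hinner : ⟪η, Φ a ξ⟫_ℂ = ⟪η, Φ b ξ⟫_ℂ := by
    rw [Submodule.coe_inner, Submodule.coe_inner, hcomp, hqξ, ← hq.isSelfAdjoint.adjoint_eq,
      ContinuousLinearMap.adjoint_inner_right, apply_eq_of_mem_range hq.isIdempotentElem hη]
  calc ‖⟪η, Φ a ξ⟫_ℂ‖ ≤ ‖η‖ * ‖Φ b ξ‖ := hinner ▸ norm_inner_le_norm _ _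
    _ ≤ ‖η‖ * (|C| * (‖p‖ ^ 2 * ‖a‖) * ‖ξ‖) := by
      gcongr
      refine (hC a b rfl ξ).trans ?_
      gcongr
      exacts [le_abs_self C, norm_rightMul_leftMul_le p a]
    _ = |C| * ‖p‖ ^ 2 * ‖a‖ * ‖ξ‖ * ‖η‖ := by ring

theorem IsBoundedCompression.isBoundedOnCorner (h : IsBoundedCompression Φ q)
    (hq : IsStarProjection q) (hpA : ∀ a ∈ A, rightMul (leftMul p a) p ∈ A) (hqX : ∀ x, q x ∈ X)
    (hcomp : ∀ (a : A) (ξ : X), (Φ ⟨rightMul (leftMul p (a : B)) p, hpA a a.2⟩ ξ : H) =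
      q (Φ a ⟨q ξ, hqX ξ⟩)) :
    IsBoundedOnCorner Φ p := by
  obtain ⟨C, hC₀, hC⟩ := h
  refine ⟨C, fun a b hb ξ => ?_⟩
  obtain rfl : b = ⟨_, hpA a a.2⟩ := Subtype.ext hb
  set b : A := ⟨_, hpA a a.2⟩
  let ζ : X := ⟨q ξ, hqX ξ⟩
  have hqζ : (⟨q ζ, hqX ζ⟩ : X) = ζ :=
    Subtype.ext (apply_eq_of_mem_range hq.isIdempotentElem ⟨ξ, rfl⟩)
  have hζ : Φ b ξ = Φ b ζ := Subtype.ext <| by rw [hcomp, hcomp, hqζ]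
  have hrange : (Φ b ζ : H) ∈ Set.range q := ⟨_, (hcomp a ζ).symm⟩
  have hnormζ : ‖ζ‖ ≤ ‖ξ‖ :=
    (q.le_of_opNorm_le (IsStarProjection.norm_le q hq) (ξ : H)).trans_eq (one_mul _)
  have hsq : ‖Φ b ζ‖ * ‖Φ b ζ‖ ≤ C * ‖b‖ * ‖ζ‖ * ‖Φ b ζ‖ := by
    rw [← inner_self_eq_norm_mul_norm (𝕜 := ℂ), inner_self_re_eq_norm]
    exact hC b ζ (Φ b ζ) ⟨ξ, rfl⟩ hrange
  calc ‖Φ b ξ‖ = ‖Φ b ζ‖ := by rw [hζ]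
    _ ≤ C * ‖b‖ * ‖ζ‖ := le_of_mul_self_le_mul_right (by positivity) hsq
    _ ≤ C * ‖b‖ * ‖ξ‖ := by gcongr

end Corner

section Union

variable {K : Type w} [NormedAddCommGroup K] [InnerProductSpace ℂ K] {q : ℕ → (H →L[ℂ] H)}
  {V : X →ₗ[ℂ] K}

theorem isSeparable_range_of_bounded_on_range [SeparableSpace H]
    (hX : (X : Set H) = ⋃ k, Set.range (q k))
    (hV : ∀ k, ∃ C : ℝ, ∀ ξ : X, (ξ : H) ∈ Set.range (q k) → ‖V ξ‖ ≤ C * ‖ξ‖) :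
    IsSeparable (Set.range V) := by
  have hqX (k : ℕ) (x : H) : q k x ∈ X := hX.ge (Set.mem_iUnion.2 ⟨k, x, rfl⟩)
  let L (k : ℕ) : H →ₗ[ℂ] K := V ∘ₗ (q k : H →ₗ[ℂ] H).codRestrict X (hqX k)
  have hL (k : ℕ) : Continuous (L k) := by
    obtain ⟨C, hC⟩ := hV k
    refine ((L k).mkContinuous (|C| * ‖q k‖) fun x => (hC _ ⟨x, rfl⟩).trans ?_).continuous
    rw [mul_assoc]
    gcongr
    exacts [le_abs_self C, (q k).le_opNorm x]
  refine (IsSeparable.iUnion fun k => isSeparable_range (hL k)).mono ?_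
  rintro _ ⟨ξ, rfl⟩
  obtain ⟨k, x, hx⟩ := Set.mem_iUnion.1 (hX.le ξ.2)
  exact Set.mem_iUnion.2 ⟨k, x, congrArg V (Subtype.ext hx)⟩

variable [CompleteSpace K] {π : A →⋆ₙₐ[ℂ] (K →L[ℂ] K)}

theorem IsStinespringRep.isBoundedCompression (h : IsStinespringRep q Φ π V) (k : ℕ) :
    IsBoundedCompression Φ (q k) := by
  obtain ⟨C, hC⟩ := h.bounded_rep
  obtain ⟨D, hD⟩ := h.bounded_on_range k
  refine ⟨|D| * |C| * |D|, by positivity, fun a ξ η hξ hη => ?_⟩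
  have hV {ζ : X} (hζ : (ζ : H) ∈ Set.range (q k)) : ‖V ζ‖ ≤ |D| * ‖ζ‖ :=
    (hD ζ hζ).trans (by gcongr; exact le_abs_self D)
  have hπ : ‖π a‖ ≤ |C| * ‖a‖ := (hC a).trans (by gcongr; exacts [le_abs_self C, le_rfl])
  calc ‖⟪η, Φ a ξ⟫_ℂ‖ = ‖⟪V η, π a (V ξ)⟫_ℂ‖ := by rw [h.inner_eq]
    _ ≤ ‖V η‖ * (‖π a‖ * ‖V ξ‖) :=
      (norm_inner_le_norm _ _).trans (by gcongr; exact (π a).le_opNorm _)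
    _ ≤ (|D| * ‖η‖) * ((|C| * ‖a‖) * (|D| * ‖ξ‖)) := by gcongr; exacts [hV hη, hV hξ]
    _ = |D| * |C| * |D| * ‖a‖ * ‖ξ‖ * ‖η‖ := by ring

theorem IsMinimalDilation.isStinespringRep {J : A ⊗[ℂ] X →ₗ[ℂ] K}
    (h : IsMinimalDilation Φ J π V) (hc : IsWeaklyContinuous Φ)
    (hb : ∀ k, IsBoundedCompression Φ (q k)) : IsStinespringRep q Φ π V where
  bounded_rep := ⟨1, fun a => (h.norm_le a).trans_eq (one_mul _).symm⟩
  inner_eq := h.inner_apply_eq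
  bounded_on_range k := by
    obtain ⟨C, hC₀, hC⟩ := hb k
    refine ⟨2 * √C, fun ξ hξ => ?_⟩
    rw [mul_assoc]
    refine h.norm_apply_le hc (by positivity) fun a => (hC a ξ ξ hξ hξ).trans_eq ?_
    rw [mul_pow, Real.sq_sqrt hC₀]
    ring

theorem range_mono [CompleteSpace H] (hq : IsIncreasingProjections q) :
    Monotone fun k => Set.range (q k) := by
  rintro k m hkm _ ⟨x, rfl⟩
  have hmk : q m * q k = q k := by
    simpa only [star_mul, (hq.isStarProjection _).isSelfAdjoint.star_eq] using
      congrArg star (hq.mul_eq k m hkm)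
  exact ⟨q k x, DFunLike.congr_fun hmk x⟩

theorem isWeaklyContinuous_of_isBoundedCompression [CompleteSpace H]
    (hq : IsIncreasingProjections q) (hX : (X : Set H) = ⋃ k, Set.range (q k))
    (h : ∀ k, IsBoundedCompression Φ (q k)) : IsWeaklyContinuous Φ := by
  intro η ξ
  obtain ⟨k, hk⟩ := Set.mem_iUnion.1 (hX.le η.2)
  obtain ⟨m, hm⟩ := Set.mem_iUnion.1 (hX.le ξ.2)
  exact (h (max k m)).continuous_inner (range_mono hq (le_max_right k m) hm)
    (range_mono hq (le_max_left k m) hk)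

theorem exists_isStinespringRep [CompleteSpace H] (hq : IsIncreasingProjections q)
    (hX : (X : Set H) = ⋃ k, Set.range (q k)) (hΦ : IsCompletelyPositive Φ)
    (hb : ∀ k, IsBoundedCompression Φ (q k)) :
    ∃ (K : Type (max u v)) (_ : NormedAddCommGroup K) (_ : InnerProductSpace ℂ K)
      (_ : CompleteSpace K) (π : A →⋆ₙₐ[ℂ] (K →L[ℂ] K)) (V : X →ₗ[ℂ] K),
      IsStinespringRep q Φ π V ∧ LinearPMap.IsClosable (⟨X, V⟩ : H →ₗ.[ℂ] K) ∧
      (SeparableSpace B → SeparableSpace H → SeparableSpace K) := by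
  have hc := isWeaklyContinuous_of_isBoundedCompression hq hX hb
  obtain ⟨K, _, _, _, J, π, V, h⟩ := hΦ.exists_isMinimalDilation hc
  have hrep := h.isStinespringRep hc hb
  exact ⟨K, _, _, ‹_›, π, V, hrep, h.isClosable, fun _ _ =>
    h.separableSpace (isSeparable_range_of_bounded_on_range hX hrep.bounded_on_range)⟩

end Union

end Filtration

end UnboundedStinespring

open UnboundedStinespring in
theorem theorem2p1_general
    {B : Type u} [NonUnitalCStarAlgebra B] (A : NonUnitalStarSubalgebra ℂ B)
    (p : ℕ → 𝓜(ℂ, B)) (hpA : ∀ k, ∀ a ∈ A, rightMul (leftMul (p k) a) (p k) ∈ A)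
    {H : Type v} [NormedAddCommGroup H] [InnerProductSpace ℂ H] [CompleteSpace H]
    (q : ℕ → (H →L[ℂ] H)) (hq : IsIncreasingProjections q)
    (X : Submodule ℂ H) (hX : (X : Set H) = ⋃ k, Set.range (q k))
    (Φ : A →ₗ[ℂ] (X →ₗ[ℂ] X)) (hΦ : IsCompletelyPositive Φ)
    (hcomp : ∀ (k : ℕ) (a : A) (ξ : X),
      ((Φ ⟨rightMul (leftMul (p k) (a : B)) (p k), hpA k _ a.2⟩ ξ : X) : H) =
        q k (Φ a ⟨q k ξ, hX.ge (Set.mem_iUnion.2 ⟨k, (ξ : H), rfl⟩)⟩)) :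
    ((∀ k, IsBoundedOnCorner Φ (p k)) ↔
      ∃ (K : Type (max u v)) (_ : NormedAddCommGroup K) (_ : InnerProductSpace ℂ K)
        (_ : CompleteSpace K) (π : A →⋆ₙₐ[ℂ] (K →L[ℂ] K)) (V : X →ₗ[ℂ] K),
        IsStinespringRep q Φ π V) ∧
    ((∀ k, IsBoundedOnCorner Φ (p k)) →
      ∃ (K : Type (max u v)) (_ : NormedAddCommGroup K) (_ : InnerProductSpace ℂ K)
        (_ : CompleteSpace K) (π : A →⋆ₙₐ[ℂ] (K →L[ℂ] K)) (V : X →ₗ[ℂ] K),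
        IsStinespringRep q Φ π V ∧ LinearPMap.IsClosable (⟨X, V⟩ : H →ₗ.[ℂ] K) ∧
        (TopologicalSpace.SeparableSpace B → TopologicalSpace.SeparableSpace H →
          TopologicalSpace.SeparableSpace K)) := by
  have hqX (k : ℕ) (x : H) : q k x ∈ X := hX.ge (Set.mem_iUnion.2 ⟨k, x, rfl⟩)
  have hiff (k : ℕ) : IsBoundedOnCorner Φ (p k) ↔ IsBoundedCompression Φ (q k) :=
    ⟨fun h => h.isBoundedCompression (hq.isStarProjection k) (hpA k) (hqX k) (hcomp k),
      fun h => h.isBoundedOnCorner (hq.isStarProjection k) (hpA k) (hqX k) (hcomp k)⟩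
  have hdil (h : ∀ k, IsBoundedOnCorner Φ (p k)) :=
    exists_isStinespringRep hq hX hΦ fun k => (hiff k).1 (h k)
  refine ⟨⟨fun h => ?_, ?_⟩, hdil⟩
  · obtain ⟨K, _, _, _, π, V, hrep, -⟩ := hdil h
    exact ⟨K, _, _, ‹_›, π, V, hrep⟩
  · rintro ⟨K, _, _, _, π, V, hrep⟩ k
    exact (hiff k).2 (hrep.isBoundedCompression k)

open UnboundedStinespring in
theorem theorem2p1
    {B : Type u} [NonUnitalCStarAlgebra B]
    (A : NonUnitalStarSubalgebra ℂ B) (hA : Dense (A : Set B))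
    (p : ℕ → 𝓜(ℂ, B)) (hp : IsIncreasingProjections p)
    (hpA : ∀ n, ∀ a ∈ A, leftMul (p n) a ∈ A)
    (hAp : ∀ n, ∀ a ∈ A, rightMul a (p n) ∈ A)
    (hAunion : (A : Set B) = ⋃ k, (fun a => rightMul (leftMul (p k) a) (p k)) '' (A : Set B))
    {H : Type v} [NormedAddCommGroup H] [InnerProductSpace ℂ H] [CompleteSpace H]
    (q : ℕ → (H →L[ℂ] H)) (hq : IsIncreasingProjections q)
    (hqlim : ∀ ξ : H, Tendsto (fun k => q k ξ) atTop (𝓝 ξ))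
    (X : Submodule ℂ H) (hX : (X : Set H) = ⋃ k, Set.range (q k))
    (Φ : A →ₗ[ℂ] (X →ₗ[ℂ] X)) (hΦ : IsCompletelyPositive Φ)
    (hcomp : ∀ (k m : ℕ) (a : A) (ξ : X),
      ((Φ ⟨rightMul (leftMul (p k) (a : B)) (p m), hAp m _ (hpA k _ a.2)⟩ ξ : X) : H) =
        q k (Φ a ⟨q m ξ, hX.ge (Set.mem_iUnion.2 ⟨m, (ξ : H), rfl⟩)⟩)) :
    ((∀ k, IsBoundedOnCorner Φ (p k)) ↔
      ∃ (K : Type (max u v)) (_ : NormedAddCommGroup K) (_ : InnerProductSpace ℂ K)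
        (_ : CompleteSpace K) (π : A →⋆ₙₐ[ℂ] (K →L[ℂ] K)) (V : X →ₗ[ℂ] K),
        IsStinespringRep q Φ π V) ∧
    ((∀ k, IsBoundedOnCorner Φ (p k)) →
      ∃ (K : Type (max u v)) (_ : NormedAddCommGroup K) (_ : InnerProductSpace ℂ K)
        (_ : CompleteSpace K) (π : A →⋆ₙₐ[ℂ] (K →L[ℂ] K)) (V : X →ₗ[ℂ] K),
        IsStinespringRep q Φ π V ∧ LinearPMap.IsClosable (⟨X, V⟩ : H →ₗ.[ℂ] K) ∧
        (TopologicalSpace.SeparableSpace B → TopologicalSpace.SeparableSpace H →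
          TopologicalSpace.SeparableSpace K)) :=
  theorem2p1_general A p (fun k _ ha => hAp k _ (hpA k _ ha)) q hq X hX Φ hΦ fun k => hcomp k k
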